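/- Let $\perp$ be a classical polarity of a finite-dimensional vector space $V$ over a finite field $K$, i.e. the orthogonality given by a nondegenerate form that is alternating, or symmetric with $\operatorname{char} K\ne 2$, or Hermitian with respect to an automorphism of $K$ of order two. A subspace $S$ is isotropic if $S\subseteq S^\perp$; the isotropic subspaces form a finite classical polar space, whose rank $d$ is the largest dimension of an isotropic subspace. Its collinearity graph $\Gamma$ has the isotropic $1$-spaces (points) as vertices, two distinct ones being adjacent if they lie in a common isotropic $2$-space. For a finite graph $\Gamma$, a pair $\{C_1,C_2\}$ of disjoint vertex sets is a switching set if $|C_1|=|C_2|$, the induced subgraphs on $C_1$, $C_2$ and $C_1\cup C_2$ are regular, the first two of the same degree, and every vertex $x\notin C_1\cup C_2$, with neighbourhood $\Gamma(x)$, satisfies $|\Gamma(x)\cap C_1|=|\Gamma(x)\cap C_2|$ or $\Gamma(x)\cap(C_1\cup C_2)\in\{C_1,C_2\}$. The graph $\overline\Gamma$ obtained by switching arises from $\Gamma$ by replacing, for every $x\notin C_1\cup C_2$ with $\Gamma(x)\cap (C_1\cup C_2)=C_i$, the neighbours $C_i$ of $x$ in $C_1\cup C_2$ by $C_{3-i}$.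 Two graphs are cospectral if their adjacency matrices $A,\overline A$ satisfy $Q^TAQ=\overline A$ for some real orthogonal matrix $Q$. Let $P$ be an isotropic subspace of dimension $m$, let $L_1\ne L_2$ be hyperplanes of $P$, and let $C_1$ (respectively $C_2$) be the set of points in $L_1$ but not in $L_2$ (respectively in $L_2$ but not in $L_1$). Then $\{C_1,C_2\}$ is a switching set of $\Gamma$, and the graph $\overline\Gamma$ obtained by switching is cospectral with $\Gamma$. If $d=m\ge 3$, then $\overline\Gamma$ is not isomorphic to $\Gamma$. In particular, if $d\ge 3$, then $\Gamma$ is not determined by its spectrum: there is a graph cospectral with $\Gamma$ but not isomorphic to it. -/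

import Mathlib

/-! ## Cospectral graphs and switching of finite graphs -/

section Graphs

open Classical in
/-- Two graphs on the same finite vertex set are cospectral if their adjacency matrices are
conjugate under a real orthogonal matrix (equivalently, have the same spectrum). -/
def Cospectral {α : Type*} [Finite α] (G H : SimpleGraph α) : Prop :=
  letI : Fintype α := Fintype.ofFinite α
  ∃ Q ∈ Matrix.orthogonalGroup α ℝ, Q.transpose * G.adjMatrix ℝ * Q = H.adjMatrix ℝ

/-- A finite graph is determined by its spectrum if every graph that is cospectral to it is
isomorphic to it. (Cospectral graphs have equally many vertices, so it suffices to look at graphs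
on the same vertex set.) -/
def DeterminedBySpectrum {α : Type*} [Finite α] (G : SimpleGraph α) : Prop :=
  ∀ H : SimpleGraph α, Cospectral G H → Nonempty (G ≃g H)

/-- `G` induces on `C` a regular graph of degree `k`. -/
def InducesRegular {α : Type*} [Finite α] (G : SimpleGraph α) (C : Set α) (k : ℕ) : Prop :=
  ∀ x ∈ C, (G.neighborSet x ∩ C).ncard = k

/-- The pair `{C₁, C₂}` is a switching set of the finite graph `G`: with `D` the complement of
`C₁ ∪ C₂`, the sets `C₁`, `C₂`, `D` partition the vertices, `C₁` and `C₂` are of the same size and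
induce regular graphs of the same degree, `C₁ ∪ C₂` induces a regular graph, and every vertex in `D`
has equally many neighbours in `C₁` and in `C₂`, or its neighbourhood meets `C₁ ∪ C₂` exactly in
`C₁` or exactly in `C₂`. -/
structure IsSwitchingSet {α : Type*} [Finite α] (G : SimpleGraph α) (C₁ C₂ : Set α) : Prop where
  disjoint : Disjoint C₁ C₂
  ncard_eq : C₁.ncard = C₂.ncard
  regular_parts : ∃ k, InducesRegular G C₁ k ∧ InducesRegular G C₂ k
  regular_union : ∃ k, InducesRegular G (C₁ ∪ C₂) k
  outside : ∀ x ∉ C₁ ∪ C₂,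
    (G.neighborSet x ∩ C₁).ncard = (G.neighborSet x ∩ C₂).ncard ∨
      G.neighborSet x ∩ (C₁ ∪ C₂) = C₁ ∨ G.neighborSet x ∩ (C₁ ∪ C₂) = C₂

open Classical in
/-- The set of neighbours in `C₁ ∪ C₂`, after switching, of a vertex `x` outside `C₁ ∪ C₂`. -/
def switchedNeighbors {α : Type*} (G : SimpleGraph α) (C₁ C₂ : Set α) (x : α) : Set α :=
  if G.neighborSet x ∩ (C₁ ∪ C₂) = C₂ then C₁
  else if G.neighborSet x ∩ (C₁ ∪ C₂) = C₁ then C₂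
  else G.neighborSet x ∩ (C₁ ∪ C₂)

theorem switchedNeighbors_subset {α : Type*} (G : SimpleGraph α) (C₁ C₂ : Set α) (x : α) :
    switchedNeighbors G C₁ C₂ x ⊆ C₁ ∪ C₂ := by
  unfold switchedNeighbors
  split_ifs
  · exact Set.subset_union_left
  · exact Set.subset_union_right
  · exact Set.inter_subset_right

/-- The graph obtained from `G` by switching with respect to `{C₁, C₂}`: only the edges between
`C₁ ∪ C₂` and its complement are modified. -/
def switchedGraph {α : Type*} (G : SimpleGraph α) (C₁ C₂ : Set α) : SimpleGraph α where
  Adj x y :=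
    ((x ∈ C₁ ∪ C₂ ↔ y ∈ C₁ ∪ C₂) ∧ G.Adj x y) ∨
    (x ∉ C₁ ∪ C₂ ∧ y ∈ switchedNeighbors G C₁ C₂ x) ∨
    (y ∉ C₁ ∪ C₂ ∧ x ∈ switchedNeighbors G C₁ C₂ y)
  symm := ⟨fun x y h => by
    rcases h with h | h | h
    · exact Or.inl ⟨h.1.symm, h.2.symm⟩
    · exact Or.inr (Or.inr h)
    · exact Or.inr (Or.inl h)⟩
  loopless := ⟨fun x h => by
    rcases h with h | h | h
    · exact G.loopless.irrefl x h.2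
    · exact h.1 (switchedNeighbors_subset G C₁ C₂ x h.2)
    · exact h.1 (switchedNeighbors_subset G C₁ C₂ x h.2)⟩

end Graphs

/-! ## Classical polar spaces given by a polarity -/

/-- A classical polarity on the vector space `V` over `K`, given by a nondegenerate form `B` that is
alternating (symplectic type), symmetric in characteristic different from two (orthogonal type), or
Hermitian with respect to an involutory automorphism of `K` (unitary type). -/
structure ClassicalPolarity (K V : Type*) [Field K] [AddCommGroup V] [Module K V] where
  σ : K →+* K
  form : V →ₛₗ[σ] V →ₗ[K] K
  nondegenerate : form.Nondegenerate
  type :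
    (σ = RingHom.id K ∧ ∀ x, form x x = 0) ∨
    (σ = RingHom.id K ∧ (2 : K) ≠ 0 ∧ ∀ x y, form y x = form x y) ∨
    (σ ≠ RingHom.id K ∧ (∀ a, σ (σ a) = a) ∧ ∀ x y, form y x = σ (form x y))

namespace ClassicalPolarity

variable {K V : Type*} [Field K] [AddCommGroup V] [Module K V]

/-- The image `S⊥` of a subspace `S` under the polarity. -/
def perp (pol : ClassicalPolarity K V) (S : Submodule K V) : Submodule K V :=
  S.orthogonalBilin pol.form

/-- A subspace `S` is isotropic if `S ⊆ S⊥`; the polar space consists of these subspaces. -/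
def IsIsotropic (pol : ClassicalPolarity K V) (S : Submodule K V) : Prop :=
  S ≤ pol.perp S

/-- The polar space has rank `d`: the largest dimension of an isotropic subspace is `d`. -/
def HasRank (pol : ClassicalPolarity K V) (d : ℕ) : Prop :=
  IsGreatest {k | ∃ S : Submodule K V, pol.IsIsotropic S ∧ Module.finrank K S = k} d

/-- The isotropic points: the isotropic one-dimensional subspaces. -/
def Point (pol : ClassicalPolarity K V) : Type _ :=
  {p : Projectivization K V // pol.IsIsotropic p.submodule}

/-- A point as a subspace. -/
def Point.toSubmodule {pol : ClassicalPolarity K V} (p : pol.Point) : Submodule K V :=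
  p.1.submodule

instance Point.instFinite [Finite K] [FiniteDimensional K V] (pol : ClassicalPolarity K V) :
    Finite pol.Point :=
  haveI : Finite V := Module.finite_of_finite K
  inferInstanceAs (Finite {p : Projectivization K V // pol.IsIsotropic p.submodule})

/-- The collinearity graph: distinct isotropic points are adjacent if they lie on a common isotropic
line. -/
def collinearityGraph (pol : ClassicalPolarity K V) : SimpleGraph pol.Point where
  Adj p q := p ≠ q ∧ ∃ ℓ : Submodule K V, pol.IsIsotropic ℓ ∧ Module.finrank K ℓ = 2 ∧
    p.toSubmodule ≤ ℓ ∧ q.toSubmodule ≤ ℓ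
  symm := ⟨fun _ _ ⟨h, ℓ, h1, h2, h3, h4⟩ => ⟨h.symm, ℓ, h1, h2, h4, h3⟩⟩
  loopless := ⟨fun _ h => h.1 rfl⟩

/-- The set of isotropic points that lie in `L` but not in `M`. -/
def pointsDiff (pol : ClassicalPolarity K V) (L M : Submodule K V) : Set pol.Point :=
  {p | p.toSubmodule ≤ L ∧ ¬ p.toSubmodule ≤ M}

end ClassicalPolarity

/-- `L` is a hyperplane of the (finite-dimensional) subspace `P`. -/
def IsHyperplaneOf {K V : Type*} [Field K] [AddCommGroup V] [Module K V]
    (L P : Submodule K V) : Prop :=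
  L ≤ P ∧ Module.finrank K L + 1 = Module.finrank K P

/-!
The argument has three parts.

*Cospectrality.* For a switching set `{C₁, C₂}` of any finite graph, let `u = 1_{C₁} - 1_{C₂}` and
`c = |C₁|`. Regularity gives `A u = κ u + w`, where `w` is supported outside `C₁ ∪ C₂` with values
`0`, `c`, `-c`; hence conjugating `A` by the reflection `1 - c⁻¹ u uᵀ` subtracts
`c⁻¹ (u wᵀ + w uᵀ)`, which is exactly the effect of switching
(`IsSwitchingSet.cospectral`).

*Switching set.* All points of `P` are pairwise collinear, so regularity is clear. A point `x`
outside `C₁ ∪ C₂` with exactly one of `L₁`, `L₂` in `x⊥` has that `Cᵢ` as its set of neighbours.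
Otherwise `L₁ ∩ x⊥` and `L₂ ∩ x⊥` have the same dimension, and counting the points of projective
spaces gives equally many neighbours in `C₁` and `C₂` (`ClassicalPolarity.isSwitchingSet`).

*Non-isomorphism.* In the collinearity graph, any two adjacent points `x`, `y` have a third point
`z` on their line, and everything orthogonal to `x` and `y` is orthogonal to `z`
(`HasThirdVertex`). When `P` is a maximal isotropic subspace, switching destroys this property: a
point outside `P` with `x⊥ ∩ P = L₁` becomes joined to the points of `L₂`, and for such an `x` and a
point `p` in `L₂` but not in `L₁`, no third vertex exists
(`ClassicalPolarity.not_hasThirdVertex_switchedGraph`). The vertices that refute a candidate `z`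
come from `ClassicalPolarity.exists_point_orthogonal`, which produces isotropic points with
prescribed orthogonality relations from nondegeneracy of the form together with
`ClassicalPolarity.exists_isotropic_add_smul`.
-/

/-! ### Switching and cospectrality -/

section Switching

variable {α : Type*}

/-- The number of neighbours of `x` in `S`, as a row of the adjacency matrix applied to the
indicator vector of `S`. -/
theorem adjMatrix_mulVec_indicator [Fintype α] (G : SimpleGraph α) [DecidableRel G.Adj]
    (S : Set α) (x : α) :
    (G.adjMatrix ℝ).mulVec (S.indicator 1) x = ((G.neighborSet x ∩ S).ncard : ℝ) := by
  classical
  rw [Set.ncard_eq_toFinset_card', Matrix.mulVec, dotProduct, Finset.card_eq_sum_ones,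
    Nat.cast_sum, ← Finset.sum_filter_add_sum_filter_not Finset.univ
      (fun y => y ∈ G.neighborSet x ∩ S)]
  rw [Finset.sum_eq_zero (s := Finset.univ.filter (fun y => ¬ y ∈ G.neighborSet x ∩ S)), add_zero]
  · refine Finset.sum_congr (by ext; simp) fun y hy => ?_
    have hy' : y ∈ G.neighborSet x ∩ S := by simpa using hy
    have h1 : G.Adj x y := hy'.1
    simp [SimpleGraph.adjMatrix_apply, h1, hy'.2]
  · intro y hy
    simp only [Finset.mem_filter, Finset.mem_univ, true_and, Set.mem_inter_iff,
      SimpleGraph.mem_neighborSet, not_and] at hy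
    by_cases h : G.Adj x y
    · simp [hy h]
    · simp [SimpleGraph.adjMatrix_apply, h]

theorem indicator_dotProduct_indicator [Fintype α] (S T : Set α) :
    (S.indicator 1 : α → ℝ) ⬝ᵥ T.indicator 1 = ((S ∩ T).ncard : ℝ) := by
  classical
  rw [Set.ncard_eq_toFinset_card', dotProduct, Finset.card_eq_sum_ones, Nat.cast_sum,
    ← Finset.sum_subset (Finset.subset_univ (S ∩ T).toFinset)]
  · refine Finset.sum_congr rfl fun y hy => ?_
    have hy' : y ∈ S ∩ T := by simpa using hy
    simp [hy'.1, hy'.2]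
  · intro y _ hy
    simp only [Set.mem_toFinset, Set.mem_inter_iff, not_and] at hy
    by_cases h : y ∈ S
    · simp [hy h]
    · simp [h]

theorem conj_reflection_apply [Fintype α] [DecidableEq α] (A : Matrix α α ℝ)
    (hA : A.transpose = A) (u : α → ℝ) (c : ℝ) (i j : α) :
    ((1 - c⁻¹ • Matrix.vecMulVec u u) * A * (1 - c⁻¹ • Matrix.vecMulVec u u)) i j =
      A i j - c⁻¹ * (u i * A.mulVec u j + A.mulVec u i * u j) +
        c⁻¹ * c⁻¹ * (u ⬝ᵥ A.mulVec u) * (u i * u j) := by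
  have hv : Matrix.vecMul u A = A.mulVec u := by
    rw [← Matrix.mulVec_transpose, hA]
  simp only [Matrix.sub_mul, Matrix.mul_sub, Matrix.one_mul, Matrix.mul_one, Matrix.smul_mul,
    Matrix.mul_smul, Matrix.vecMulVec_mul, Matrix.mul_vecMulVec, hv, Matrix.sub_apply,
    Matrix.sub_mulVec, Matrix.smul_mulVec, Matrix.vecMulVec_mulVec, Pi.sub_apply, Pi.smul_apply,
    op_smul_eq_smul,
    dotProduct_comm (A.mulVec u) u,
    Matrix.smul_apply, Matrix.vecMulVec_apply, smul_eq_mul]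
  ring

theorem switchedGraph_adj_of_iff (G : SimpleGraph α) {C₁ C₂ : Set α} {x y : α}
    (h : x ∈ C₁ ∪ C₂ ↔ y ∈ C₁ ∪ C₂) : (switchedGraph G C₁ C₂).Adj x y ↔ G.Adj x y := by
  have h1 := @switchedNeighbors_subset α G C₁ C₂
  constructor
  · rintro (h2 | h2 | h2)
    · exact h2.2
    · exact absurd (h.2 (h1 x h2.2)) h2.1
    · exact absurd (h.1 (h1 y h2.2)) h2.1
  · exact fun h2 => Or.inl ⟨h, h2⟩

theorem switchedGraph_adj_of_notMem (G : SimpleGraph α) {C₁ C₂ : Set α} {x y : α}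
    (hx : x ∉ C₁ ∪ C₂) (hy : y ∈ C₁ ∪ C₂) :
    (switchedGraph G C₁ C₂).Adj x y ↔ y ∈ switchedNeighbors G C₁ C₂ x := by
  constructor
  · rintro (h | h | h)
    · exact absurd (h.1.2 hy) hx
    · exact h.2
    · exact absurd hy h.1
  · exact fun h => Or.inr (Or.inl ⟨hx, h⟩)

/-- The entries of the switched adjacency matrix between a vertex `x` outside and a vertex `y`
inside the switching set. -/
theorem adjMatrix_switchedGraph_apply [Fintype α] (G : SimpleGraph α) {C₁ C₂ : Set α}
    [DecidableRel G.Adj] [DecidableRel (switchedGraph G C₁ C₂).Adj] (h : IsSwitchingSet G C₁ C₂)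
    {x y : α} (hx : x ∉ C₁ ∪ C₂) (hy : y ∈ C₁ ∪ C₂) :
    G.adjMatrix ℝ x y - (C₁.ncard : ℝ)⁻¹ *
        ((((G.neighborSet x ∩ C₁).ncard : ℝ) - (G.neighborSet x ∩ C₂).ncard) *
          ((C₁.indicator 1 y : ℝ) - C₂.indicator 1 y)) =
      (switchedGraph G C₁ C₂).adjMatrix ℝ x y := by
  classical
  have hd : ∀ z, z ∈ C₁ → z ∉ C₂ := fun z h1 h2 => Set.disjoint_left.1 h.disjoint h1 h2
  have hc0 : (C₁.ncard : ℝ) ≠ 0 := by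
    rcases hy with hy | hy
    · exact_mod_cast ((Set.ncard_pos (Set.toFinite _)).2 ⟨y, hy⟩).ne'
    · rw [h.ncard_eq]
      exact_mod_cast ((Set.ncard_pos (Set.toFinite _)).2 ⟨y, hy⟩).ne'
  have hC₁ : G.neighborSet x ∩ (C₁ ∪ C₂) = C₁ →
      G.neighborSet x ∩ C₁ = C₁ ∧ G.neighborSet x ∩ C₂ = ∅ := by
    intro hN
    constructor
    · ext z
      have := Set.ext_iff.1 hN z
      simp only [Set.mem_inter_iff, Set.mem_union] at this ⊢
      tauto
    · ext z
      have := Set.ext_iff.1 hN z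
      have := hd z
      simp only [Set.mem_inter_iff, Set.mem_union, Set.mem_empty_iff_false] at *
      tauto
  have hC₂ : G.neighborSet x ∩ (C₁ ∪ C₂) = C₂ →
      G.neighborSet x ∩ C₁ = ∅ ∧ G.neighborSet x ∩ C₂ = C₂ := by
    intro hN
    constructor
    · ext z
      have := Set.ext_iff.1 hN z
      have := hd z
      simp only [Set.mem_inter_iff, Set.mem_union, Set.mem_empty_iff_false] at *
      tauto
    · ext z
      have := Set.ext_iff.1 hN z
      simp only [Set.mem_inter_iff, Set.mem_union] at this ⊢
      tauto
  rw [SimpleGraph.adjMatrix_apply, SimpleGraph.adjMatrix_apply,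
    if_congr (switchedGraph_adj_of_notMem G hx hy) rfl rfl]
  have hmem : G.Adj x y ↔ y ∈ G.neighborSet x ∩ (C₁ ∪ C₂) :=
    ⟨fun h1 => ⟨h1, hy⟩, fun h1 => h1.1⟩
  by_cases h2 : G.neighborSet x ∩ (C₁ ∪ C₂) = C₂
  · obtain ⟨e1, e2⟩ := hC₂ h2
    rw [h2] at hmem
    simp only [hmem, e1, e2, switchedNeighbors, if_pos h2, ← h.ncard_eq]
    rcases hy with hy | hy
    · simp [hy, hd y hy, hc0]
    · have hy₁ : y ∉ C₁ := fun h' => hd y h' hy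
      simp [hy, hy₁, hc0]
  by_cases h1 : G.neighborSet x ∩ (C₁ ∪ C₂) = C₁
  · obtain ⟨e1, e2⟩ := hC₁ h1
    rw [h1] at hmem
    simp only [hmem, e1, e2, switchedNeighbors, if_neg h2, if_pos h1]
    rcases hy with hy | hy
    · simp [hy, hd y hy, hc0]
    · have hy₁ : y ∉ C₁ := fun h' => hd y h' hy
      simp [hy, hy₁, hc0]
  · have e := ((h.outside x hx).resolve_right (by tauto))
    simp only [hmem, switchedNeighbors, if_neg h2, if_neg h1, e]
    simp

/-- Switching with respect to a switching set preserves the spectrum: with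
`u = 1_{C₁} - 1_{C₂}` and `c = |C₁|`, the adjacency matrices are conjugate under the orthogonal
reflection `1 - c⁻¹ u uᵀ`. -/
theorem IsSwitchingSet.cospectral [Finite α] {G : SimpleGraph α} {C₁ C₂ : Set α}
    (h : IsSwitchingSet G C₁ C₂) : Cospectral G (switchedGraph G C₁ C₂) := by
  classical
  unfold Cospectral
  let _ : Fintype α := Fintype.ofFinite α
  have hd : ∀ z, z ∈ C₁ → z ∉ C₂ := fun z h1 h2 => Set.disjoint_left.1 h.disjoint h1 h2
  set u : α → ℝ := C₁.indicator 1 - C₂.indicator 1 with hu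
  set c : ℝ := (C₁.ncard : ℝ) with hc
  have huu : u ⬝ᵥ u = 2 * c := by
    have e : C₁ ∩ C₂ = ∅ := h.disjoint.inter_eq
    have e' : C₂ ∩ C₁ = ∅ := h.disjoint.symm.inter_eq
    simp only [hu, sub_dotProduct, dotProduct_sub, indicator_dotProduct_indicator, e, e',
      Set.inter_self, ← h.ncard_eq]
    simp [hc]
    ring
  have hu0 : ∀ z, z ∉ C₁ ∪ C₂ → u z = 0 := by
    intro z hz
    simp only [Set.mem_union, not_or] at hz
    simp [hu, hz.1, hz.2]
  -- if `c = 0`, then `u = 0`, and `c⁻¹ = 0` does no harm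
  have hcu : ∀ i j, c⁻¹ * c * (u i * u j) = u i * u j := by
    intro i j
    by_cases h0 : c = 0
    · have h1 : C₁ = ∅ := by
        rw [← Set.ncard_eq_zero (Set.toFinite _)]
        rw [hc] at h0
        exact_mod_cast h0
      have h2 : C₂ = ∅ := by
        rw [← Set.ncard_eq_zero (Set.toFinite _), ← h.ncard_eq, h1, Set.ncard_empty]
      simp [hu, h1, h2]
    · rw [inv_mul_cancel₀ h0, one_mul]
  set Q : Matrix α α ℝ := 1 - c⁻¹ • Matrix.vecMulVec u u with hQ
  have hQT : Q.transpose = Q := by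
    ext i j
    simp [hQ, Matrix.vecMulVec_apply, Matrix.one_apply, eq_comm, mul_comm]
  have hQQ : Q * Q = 1 := by
    ext i j
    have := conj_reflection_apply 1 Matrix.transpose_one u c i j
    rw [Matrix.mul_one] at this
    rw [hQ, this, Matrix.one_mulVec, huu]
    linear_combination 2 * c⁻¹ * hcu i j
  obtain ⟨k, hk₁, hk₂⟩ := h.regular_parts
  obtain ⟨l, hl⟩ := h.regular_union
  have hsum : ∀ x, (G.neighborSet x ∩ (C₁ ∪ C₂)).ncard =
      (G.neighborSet x ∩ C₁).ncard + (G.neighborSet x ∩ C₂).ncard := by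
    intro x
    rw [Set.inter_union_distrib_left, Set.ncard_union_eq]
    exact h.disjoint.mono Set.inter_subset_right Set.inter_subset_right
  -- the part of `A u` outside the switching set
  let w : α → ℝ := fun x => if x ∈ C₁ ∪ C₂ then 0 else
    ((G.neighborSet x ∩ C₁).ncard : ℝ) - (G.neighborSet x ∩ C₂).ncard
  have hw0 : ∀ x, x ∈ C₁ ∪ C₂ → w x = 0 := fun x hx => if_pos hx
  have hw1 : ∀ x, x ∉ C₁ ∪ C₂ →
      w x = ((G.neighborSet x ∩ C₁).ncard : ℝ) - (G.neighborSet x ∩ C₂).ncard :=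
    fun x hx => if_neg hx
  have hAu : (G.adjMatrix ℝ).mulVec u = (2 * k - l : ℝ) • u + w := by
    ext x
    rw [hu, Matrix.mulVec_sub, Pi.sub_apply, adjMatrix_mulVec_indicator,
      adjMatrix_mulVec_indicator]
    by_cases h1 : x ∈ C₁
    · have e1 := hk₁ x h1
      have e2 := hl x (Or.inl h1)
      rw [hsum x] at e2
      rw [e1] at e2 ⊢
      simp only [Pi.add_apply, Pi.smul_apply, Pi.sub_apply, Set.indicator_of_mem h1,
        Set.indicator_of_notMem (hd x h1), Pi.one_apply, smul_eq_mul, hw0 x (Or.inl h1)]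
      rw [← e2]
      push_cast
      ring
    by_cases h2 : x ∈ C₂
    · have e1 := hk₂ x h2
      have e2 := hl x (Or.inr h2)
      rw [hsum x] at e2
      rw [e1] at e2 ⊢
      simp only [Pi.add_apply, Pi.smul_apply, Pi.sub_apply, Set.indicator_of_mem h2,
        Set.indicator_of_notMem h1, Pi.one_apply, smul_eq_mul, hw0 x (Or.inr h2)]
      rw [← e2]
      push_cast
      ring
    · have h3 : x ∉ C₁ ∪ C₂ := by simp [h1, h2]
      simp [hw1 x h3, h1, h2]
  have huw : u ⬝ᵥ w = 0 := by
    refine Finset.sum_eq_zero fun x _ => ?_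
    by_cases hx : x ∈ C₁ ∪ C₂
    · rw [hw0 x hx, mul_zero]
    · rw [hu0 x hx, zero_mul]
  refine ⟨Q, ?_, ?_⟩
  · rw [Matrix.mem_orthogonalGroup_iff]
    change Q * Q.transpose = 1
    rw [hQT, hQQ]
  rw [hQT]
  ext i j
  have hent : (Q * G.adjMatrix ℝ * Q) i j =
      G.adjMatrix ℝ i j - c⁻¹ * (u i * w j + w i * u j) := by
    rw [hQ, conj_reflection_apply _ G.transpose_adjMatrix, hAu, dotProduct_add, huw,
      dotProduct_smul, huu]
    simp only [Pi.add_apply, Pi.smul_apply, smul_eq_mul]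
    linear_combination 2 * (2 * k - l : ℝ) * c⁻¹ * hcu i j
  rw [hent]
  have hadj : (i ∈ C₁ ∪ C₂ ↔ j ∈ C₁ ∪ C₂) →
      G.adjMatrix ℝ i j = (switchedGraph G C₁ C₂).adjMatrix ℝ i j := fun hij => by
    rw [SimpleGraph.adjMatrix_apply, SimpleGraph.adjMatrix_apply,
      if_congr (switchedGraph_adj_of_iff G hij) rfl rfl]
  by_cases hi : i ∈ C₁ ∪ C₂ <;> by_cases hj : j ∈ C₁ ∪ C₂
  · rw [← hadj (iff_of_true hi hj), hw0 i hi, hw0 j hj]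
    simp
  · have e := adjMatrix_switchedGraph_apply G h hj hi
    rw [← Matrix.IsSymm.apply (G.isSymm_adjMatrix),
      ← Matrix.IsSymm.apply ((switchedGraph G C₁ C₂).isSymm_adjMatrix), ← e]
    rw [hw0 i hi, hw1 j hj, hu0 j hj]
    simp only [hu, Pi.sub_apply, hc]
    ring
  · have e := adjMatrix_switchedGraph_apply G h hi hj
    rw [← e]
    rw [hw0 j hj, hw1 i hi, hu0 i hi]
    simp only [hu, Pi.sub_apply, hc]
    ring
  · rw [← hadj (iff_of_false hi hj), hu0 i hi, hu0 j hj]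
    simp

end Switching

/-! ### Orthogonality of vectors and of points -/

namespace ClassicalPolarity

variable {K V : Type*} [Field K] [AddCommGroup V] [Module K V] (pol : ClassicalPolarity K V)

theorem form_eq_zero_comm {u v : V} (h : pol.form u v = 0) : pol.form v u = 0 := by
  rcases pol.type with ⟨-, h1⟩ | ⟨-, -, h1⟩ | ⟨-, -, h1⟩
  · have e := h1 (u + v)
    simp only [map_add, LinearMap.add_apply, h1, h] at e
    simpa using e
  · rw [h1, h]
  · rw [h1, h, map_zero]

theorem IsIsotropic.form_eq_zero {pol : ClassicalPolarity K V} {S : Submodule K V}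
    (hS : pol.IsIsotropic S) {u v : V} (hu : u ∈ S) (hv : v ∈ S) : pol.form u v = 0 :=
  hS hv u hu

theorem IsIsotropic.mono {pol : ClassicalPolarity K V} {S T : Submodule K V}
    (hT : pol.IsIsotropic T) (h : S ≤ T) : pol.IsIsotropic S :=
  fun _ hv _ hu => hT.form_eq_zero (h hu) (h hv)

theorem isIsotropic_span_singleton {v : V} (h : pol.form v v = 0) :
    pol.IsIsotropic (K ∙ v) := by
  intro y hy x hx
  obtain ⟨a, rfl⟩ := Submodule.mem_span_singleton.1 hx
  obtain ⟨b, rfl⟩ := Submodule.mem_span_singleton.1 hy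
  simp [h]

theorem isIsotropic_sup {S T : Submodule K V} (hS : pol.IsIsotropic S) (hT : pol.IsIsotropic T)
    (h : ∀ u ∈ S, ∀ v ∈ T, pol.form u v = 0) : pol.IsIsotropic (S ⊔ T) := by
  intro y hy x hx
  obtain ⟨a, ha, b, hb, rfl⟩ := Submodule.mem_sup.1 hx
  obtain ⟨c, hc, e, he, rfl⟩ := Submodule.mem_sup.1 hy
  simp [hS.form_eq_zero ha hc, hT.form_eq_zero hb he, h a ha e he,
    pol.form_eq_zero_comm (h c hc b hb)]

/-- Every linear functional is represented by the form. -/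
theorem exists_form_eq [Finite K] [FiniteDimensional K V] (f : V →ₗ[K] K) :
    ∃ v, pol.form v = f := by
  have : Finite V := Module.finite_of_finite K
  have e : V ≃ Module.Dual K V :=
    (LinearEquiv.ofFinrankEq V (Module.Dual K V) Subspace.dual_finrank_eq.symm).toEquiv
  have hinj : Function.Injective (fun v => e.symm (pol.form v)) := by
    refine e.symm.injective.comp ((injective_iff_map_eq_zero pol.form).2 fun v hv => ?_)
    exact pol.nondegenerate.1 v fun y => by rw [hv, LinearMap.zero_apply]
  obtain ⟨v, hv⟩ := Finite.surjective_of_injective hinj (e.symm f)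
  exact ⟨v, e.symm.injective hv⟩

/-- A vector `v` becomes isotropic after adding a multiple of an isotropic vector that is not
orthogonal to it. In the Hermitian case the reason is that the trace to the fixed field of the
involution is surjective. -/
theorem exists_isotropic_add_smul {v t : V} (ht : pol.form t t = 0) (hvt : pol.form v t ≠ 0) :
    ∃ a : K, pol.form (v + a • t) (v + a • t) = 0 := by
  have key : ∀ a, pol.form (v + a • t) (v + a • t) =
      pol.form v v + a * pol.form v t + pol.σ a * pol.form t v := by
    intro a
    simp [ht, add_assoc]
  rcases pol.type with ⟨-, h1⟩ | ⟨hσ, h2, h1⟩ | ⟨hσ, h2, h1⟩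
  · exact ⟨0, h1 _⟩
  · have hσ' : ∀ a, pol.σ a = a := fun a => by rw [hσ, RingHom.id_apply]
    refine ⟨-pol.form v v / (2 * pol.form v t), ?_⟩
    rw [key, hσ', h1 v t]
    field_simp
    ring
  · obtain ⟨b, hb⟩ : ∃ b, b + pol.σ b ≠ 0 := by
      by_contra! hc
      have h3 := hc 1
      rw [map_one] at h3
      refine hσ (RingHom.ext fun b => ?_)
      rw [RingHom.id_apply]
      linear_combination hc b - b * h3
    have hfix : pol.σ (pol.form v v) = pol.form v v := (h1 v v).symm
    have hs : pol.σ (b + pol.σ b) = b + pol.σ b := by rw [map_add, h2, add_comm]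
    refine ⟨-pol.form v v * b / (b + pol.σ b) / pol.form v t, ?_⟩
    have hσv : pol.σ (pol.form v t) ≠ 0 := by simpa using hvt
    rw [key, h1 v t, map_div₀, map_div₀, hs, map_mul, map_neg, hfix]
    field_simp
    ring

/-- The isotropic point spanned by a nonzero isotropic vector. -/
def Point.mk (v : V) (hv : v ≠ 0) (h : pol.form v v = 0) : pol.Point :=
  ⟨Projectivization.mk K v hv, by
    rw [Projectivization.submodule_mk]; exact pol.isIsotropic_span_singleton h⟩

variable {pol}

/-- A vector spanning the point `p`. -/
noncomputable def Point.rep (p : pol.Point) : V := p.1.rep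

theorem Point.rep_ne_zero (p : pol.Point) : p.rep ≠ 0 := p.1.rep_nonzero

theorem Point.toSubmodule_eq (p : pol.Point) : p.toSubmodule = K ∙ p.rep :=
  p.1.submodule_eq

theorem Point.toSubmodule_le_iff {p : pol.Point} {S : Submodule K V} :
    p.toSubmodule ≤ S ↔ p.rep ∈ S := by
  rw [Point.toSubmodule_eq, Submodule.span_singleton_le_iff_mem]

theorem Point.form_rep_self (p : pol.Point) : pol.form p.rep p.rep = 0 := by
  have h := p.2
  change pol.IsIsotropic p.toSubmodule at h
  rw [Point.toSubmodule_eq] at h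
  exact h.form_eq_zero (Submodule.mem_span_singleton_self _) (Submodule.mem_span_singleton_self _)

theorem Point.eq_of_rep_eq_smul {p q : pol.Point} {a : K} (h : p.rep = a • q.rep) : p = q := by
  apply Subtype.ext
  rw [← p.1.mk_rep, ← q.1.mk_rep, Projectivization.mk_eq_mk_iff']
  exact ⟨a, h.symm⟩

theorem Point.toSubmodule_mk {v : V} (hv : v ≠ 0) (h : pol.form v v = 0) :
    (Point.mk pol v hv h).toSubmodule = K ∙ v :=
  Projectivization.submodule_mk v hv

theorem Point.exists_rep_mk {v : V} (hv : v ≠ 0) (h : pol.form v v = 0) :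
    ∃ a : K, a ≠ 0 ∧ (Point.mk pol v hv h).rep = a • v := by
  obtain ⟨a, ha⟩ := Projectivization.exists_smul_eq_mk_rep K v hv
  exact ⟨a, a.ne_zero, ha.symm⟩

theorem Point.rep_mk_mem_iff {v : V} (hv : v ≠ 0) (h : pol.form v v = 0) {S : Submodule K V} :
    (Point.mk pol v hv h).rep ∈ S ↔ v ∈ S := by
  rw [← Point.toSubmodule_le_iff, Point.toSubmodule_mk, Submodule.span_singleton_le_iff_mem]

theorem Point.form_rep_mk_left {v : V} (hv : v ≠ 0) (h : pol.form v v = 0) (w : V) :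
    pol.form (Point.mk pol v hv h).rep w = 0 ↔ pol.form v w = 0 := by
  obtain ⟨a, ha, e⟩ := Point.exists_rep_mk hv h
  simp [e, ha]

theorem mem_pointsDiff {L M : Submodule K V} {p : pol.Point} :
    p ∈ pol.pointsDiff L M ↔ p.rep ∈ L ∧ p.rep ∉ M := by
  rw [pointsDiff, Set.mem_ofPred_eq, Point.toSubmodule_le_iff, Point.toSubmodule_le_iff]

/-- Distinct isotropic points are collinear if and only if they are orthogonal. -/
theorem collinearityGraph_adj {p q : pol.Point} :
    pol.collinearityGraph.Adj p q ↔ p ≠ q ∧ pol.form p.rep q.rep = 0 := by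
  refine and_congr_right fun hpq => ⟨?_, fun h => ?_⟩
  · rintro ⟨l, hl, -, hp, hq⟩
    exact hl.form_eq_zero (Point.toSubmodule_le_iff.1 hp) (Point.toSubmodule_le_iff.1 hq)
  · refine ⟨p.toSubmodule ⊔ q.toSubmodule, ?_, ?_, le_sup_left, le_sup_right⟩
    · refine pol.isIsotropic_sup p.2 q.2 fun u hu v hv => ?_
      change u ∈ p.toSubmodule at hu
      change v ∈ q.toSubmodule at hv
      rw [Point.toSubmodule_eq] at hu hv
      obtain ⟨a, rfl⟩ := Submodule.mem_span_singleton.1 hu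
      obtain ⟨b, rfl⟩ := Submodule.mem_span_singleton.1 hv
      simp [h]
    · have hli : LinearIndependent K ![p.rep, q.rep] := by
        rw [LinearIndependent.pair_iff' p.rep_ne_zero]
        exact fun a ha => hpq (Point.eq_of_rep_eq_smul ha.symm).symm
      rw [Point.toSubmodule_eq, Point.toSubmodule_eq, ← Submodule.span_union]
      have e := finrank_span_eq_card hli
      rw [Matrix.range_cons, Matrix.range_cons, Matrix.range_empty, Set.union_empty] at e
      simpa using e

/-! ### Counting the points of isotropic subspaces -/

/-- An isotropic subspace `S` contains as many points as the projective space of `S`. -/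
theorem ncard_points_le {S : Submodule K V} (hS : pol.IsIsotropic S) :
    {p : pol.Point | p.toSubmodule ≤ S}.ncard = Nat.card (Projectivization K S) := by
  let g : Projectivization K S → pol.Point := fun p =>
    Point.mk pol (p.rep : V) (by simpa using p.rep_nonzero)
      (hS.form_eq_zero p.rep.2 p.rep.2)
  have hg : Function.Injective g := by
    intro p q hpq
    have h := congrArg Subtype.val hpq
    obtain ⟨a, ha⟩ := (Projectivization.mk_eq_mk_iff' K _ _ _ _).1 h
    rw [← p.mk_rep, ← q.mk_rep, Projectivization.mk_eq_mk_iff']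
    exact ⟨a, Subtype.ext ha⟩
  have hr : Set.range g = {p : pol.Point | p.toSubmodule ≤ S} := by
    ext p
    rw [Set.mem_ofPred_eq, Point.toSubmodule_le_iff]
    constructor
    · rintro ⟨q, rfl⟩
      exact (Point.rep_mk_mem_iff _ _).2 q.rep.2
    · intro hp
      have h0 : (⟨p.rep, hp⟩ : S) ≠ 0 := by simpa using p.rep_ne_zero
      refine ⟨Projectivization.mk K ⟨p.rep, hp⟩ h0, ?_⟩
      obtain ⟨a, ha⟩ := Projectivization.exists_smul_eq_mk_rep K (⟨p.rep, hp⟩ : S) h0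
      have h1 : ((Projectivization.mk K (⟨p.rep, hp⟩ : S) h0).rep : V) = (a : K) • p.rep := by
        rw [← ha]; rfl
      apply Subtype.ext
      rw [← p.1.mk_rep]
      exact (Projectivization.mk_eq_mk_iff' K _ _ _ _).2 ⟨a, h1.symm⟩
  rw [← hr, ← Set.image_univ, Set.ncard_image_of_injective _ hg, Set.ncard_univ]

theorem ncard_pointsDiff [Finite K] [FiniteDimensional K V] {L M : Submodule K V} :
    (pol.pointsDiff L M).ncard + {p : pol.Point | p.toSubmodule ≤ L ⊓ M}.ncard =
      {p : pol.Point | p.toSubmodule ≤ L}.ncard := by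
  have e : pol.pointsDiff L M =
      {p : pol.Point | p.toSubmodule ≤ L} \ {p : pol.Point | p.toSubmodule ≤ L ⊓ M} := by
    ext p
    simp only [pointsDiff, Set.mem_ofPred_eq, Set.mem_sdiff, le_inf_iff]
    tauto
  rw [e]
  exact Set.ncard_sdiff_add_ncard_of_subset
    (fun p (hp : p.toSubmodule ≤ L ⊓ M) => le_trans hp inf_le_left)

theorem ncard_pointsDiff_eq [Finite K] [FiniteDimensional K V] {L M L' M' : Submodule K V}
    (hL : pol.IsIsotropic L) (hL' : pol.IsIsotropic L')
    (h : Module.finrank K L = Module.finrank K L')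
    (h' : L ⊓ M = L' ⊓ M') :
    (pol.pointsDiff L M).ncard = (pol.pointsDiff L' M').ncard := by
  have e₁ := ncard_pointsDiff (pol := pol) (L := L) (M := M)
  have e₂ := ncard_pointsDiff (pol := pol) (L := L') (M := M')
  rw [h'] at e₁
  rw [ncard_points_le hL, Projectivization.card_of_finrank K L h] at e₁
  rw [ncard_points_le hL', Projectivization.card_of_finrank K L' rfl] at e₂
  omega

end ClassicalPolarity

/-! ### Hyperplanes of an isotropic subspace -/

/-- Intersecting with the kernel of a functional that does not vanish lowers the dimension by
one. -/
theorem Submodule.finrank_inf_ker_add_one {K V : Type*} [Field K] [AddCommGroup V] [Module K V]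
    [FiniteDimensional K V] {P : Submodule K V} {f : V →ₗ[K] K} (h : ¬ P ≤ LinearMap.ker f) :
    Module.finrank K ↥(P ⊓ LinearMap.ker f) + 1 = Module.finrank K P := by
  have h0 : f.domRestrict P ≠ 0 := fun h0 =>
    h fun v hv => LinearMap.congr_fun h0 (⟨v, hv⟩ : P)
  have e : (LinearMap.ker (f.domRestrict P)).map P.subtype = P ⊓ LinearMap.ker f := by
    rw [LinearMap.ker_domRestrict, Submodule.map_comap_subtype]
  rw [← e, Submodule.finrank_map_subtype_eq]
  exact Module.Dual.finrank_ker_add_one_of_ne_zero h0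

namespace IsHyperplaneOf

variable {K V : Type*} [Field K] [AddCommGroup V] [Module K V] [FiniteDimensional K V]
  {P L₁ L₂ : Submodule K V}

theorem eq_of_le (h₁ : IsHyperplaneOf L₁ P) (h₂ : IsHyperplaneOf L₂ P) (h : L₁ ≤ L₂) :
    L₁ = L₂ :=
  Submodule.eq_of_le_of_finrank_eq h (by have := h₁.2; have := h₂.2; omega)

theorem sup_eq (h₁ : IsHyperplaneOf L₁ P) (h₂ : IsHyperplaneOf L₂ P) (h : L₁ ≠ L₂) :
    L₁ ⊔ L₂ = P := by
  refine Submodule.eq_of_le_of_finrank_le (sup_le h₁.1 h₂.1) ?_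
  have hlt : L₁ < L₁ ⊔ L₂ := lt_of_le_of_ne le_sup_left fun e =>
    h (h₂.eq_of_le h₁ (e ▸ le_sup_right)).symm
  have := Submodule.finrank_lt_finrank_of_lt hlt
  have := h₁.2
  omega

/-- A subspace of dimension at least two has two distinct hyperplanes. -/
theorem exists_ne (P : Submodule K V) (hP : 2 ≤ Module.finrank K P) :
    ∃ L₁ L₂ : Submodule K V, IsHyperplaneOf L₁ P ∧ IsHyperplaneOf L₂ P ∧ L₁ ≠ L₂ := by
  have key : ∀ v ∈ P, v ≠ 0 → ∃ L, IsHyperplaneOf L P ∧ v ∉ L := by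
    intro v hv hv0
    obtain ⟨f, hf, -⟩ := Submodule.exists_le_ker_of_notMem (p := (⊥ : Submodule K V)) (v := v)
      (by simpa using hv0)
    refine ⟨P ⊓ LinearMap.ker f, ⟨inf_le_left, ?_⟩, fun h => hf h.2⟩
    exact Submodule.finrank_inf_ker_add_one fun h => hf (h hv)
  have hne : P ≠ ⊥ := by
    rintro rfl
    simp at hP
  obtain ⟨v, hv, hv0⟩ := Submodule.exists_mem_ne_zero_of_ne_bot hne
  obtain ⟨L, hL, hvL⟩ := key v hv hv0
  have hne' : L ≠ ⊥ := by
    rintro rfl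
    have := hL.2
    simp at this
    omega
  obtain ⟨w, hw, hw0⟩ := Submodule.exists_mem_ne_zero_of_ne_bot hne'
  obtain ⟨M, hM, hwM⟩ := key w (hL.1 hw) hw0
  exact ⟨L, M, hL, hM, fun e => hwM (e ▸ hw)⟩

end IsHyperplaneOf

/-! ### The switching set of a pair of hyperplanes -/

/-- A clique induces a regular graph. -/
theorem inducesRegular_of_pairwise_adj {α : Type*} [Finite α] {G : SimpleGraph α} {S : Set α}
    (h : ∀ x ∈ S, ∀ y ∈ S, x ≠ y → G.Adj x y) : InducesRegular G S (S.ncard - 1) := by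
  intro x hx
  have e : G.neighborSet x ∩ S = S \ {x} := by
    ext y
    constructor
    · rintro ⟨h1, h2⟩
      exact ⟨h2, fun h3 => G.ne_of_adj h1 h3.symm⟩
    · rintro ⟨h1, h2⟩
      exact ⟨h x hx y h1 fun h3 => h2 h3.symm, h1⟩
  rw [e, Set.ncard_sdiff_singleton_of_mem hx]

namespace ClassicalPolarity

variable {K V : Type*} [Field K] [AddCommGroup V] [Module K V] {pol : ClassicalPolarity K V}
  {P L₁ L₂ : Submodule K V}

theorem disjoint_pointsDiff (L M : Submodule K V) :
    Disjoint (pol.pointsDiff L M) (pol.pointsDiff M L) :=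
  Set.disjoint_left.2 fun _ h1 h2 => h1.2 h2.1

theorem rep_mem_of_mem_union (h₁ : L₁ ≤ P) (h₂ : L₂ ≤ P) {x : pol.Point}
    (hx : x ∈ pol.pointsDiff L₁ L₂ ∪ pol.pointsDiff L₂ L₁) : x.rep ∈ P := by
  rcases hx with hx | hx
  · exact h₁ (mem_pointsDiff.1 hx).1
  · exact h₂ (mem_pointsDiff.1 hx).1

theorem pointsDiff_nonempty (h₁ : L₁ ≤ P) (hP : pol.IsIsotropic P) (h : ¬ L₁ ≤ L₂) :
    (pol.pointsDiff L₁ L₂).Nonempty := by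
  obtain ⟨v, hv, hv'⟩ := SetLike.not_le_iff_exists.1 h
  have hv0 : v ≠ 0 := by
    rintro rfl
    exact hv' L₂.zero_mem
  refine ⟨Point.mk pol v hv0 (hP.form_eq_zero (h₁ hv) (h₁ hv)), mem_pointsDiff.2 ?_⟩
  rw [Point.rep_mk_mem_iff, Point.rep_mk_mem_iff]
  exact ⟨hv, hv'⟩

/-- The points of `L₁` outside `L₂` span `L₁`: a functional that vanishes on the former vanishes
on the latter. -/
theorem le_ker_of_pointsDiff (h₁ : L₁ ≤ P) (hP : pol.IsIsotropic P) (h : ¬ L₁ ≤ L₂)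
    {f : V →ₗ[K] K} (hf : ∀ y ∈ pol.pointsDiff L₁ L₂, f y.rep = 0) : L₁ ≤ LinearMap.ker f := by
  have key : ∀ v ∈ L₁, v ∉ L₂ → f v = 0 := by
    intro v hv hv'
    have hv0 : v ≠ 0 := by
      rintro rfl
      exact hv' L₂.zero_mem
    have hvv : pol.form v v = 0 := hP.form_eq_zero (h₁ hv) (h₁ hv)
    have := hf (Point.mk pol v hv0 hvv) (mem_pointsDiff.2 (by
      rw [Point.rep_mk_mem_iff, Point.rep_mk_mem_iff]
      exact ⟨hv, hv'⟩))
    obtain ⟨a, ha, e⟩ := Point.exists_rep_mk hv0 hvv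
    simpa [e, ha] using this
  obtain ⟨c, hc, hc'⟩ := SetLike.not_le_iff_exists.1 h
  intro v hv
  rw [LinearMap.mem_ker]
  by_cases hv' : v ∈ L₂
  · have e := key (v + c) (add_mem hv hc) fun h' => hc' (by simpa using sub_mem h' hv')
    rwa [map_add, key c hc hc', add_zero] at e
  · exact key v hv hv'

theorem neighborSet_inter_eq [FiniteDimensional K V] (h₁ : IsHyperplaneOf L₁ P)
    (h₂ : IsHyperplaneOf L₂ P) {x : pol.Point}
    (hx : x ∉ pol.pointsDiff L₁ L₂ ∪ pol.pointsDiff L₂ L₁)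
    (hx₁ : L₁ ≤ LinearMap.ker (pol.form x.rep)) (hx₂ : ¬ L₂ ≤ LinearMap.ker (pol.form x.rep)) :
    pol.collinearityGraph.neighborSet x ∩ (pol.pointsDiff L₁ L₂ ∪ pol.pointsDiff L₂ L₁) =
      pol.pointsDiff L₁ L₂ := by
  have hH : IsHyperplaneOf (P ⊓ LinearMap.ker (pol.form x.rep)) P :=
    ⟨inf_le_left, Submodule.finrank_inf_ker_add_one fun h => hx₂ (h₂.1.trans h)⟩
  have e := h₁.eq_of_le hH (le_inf h₁.1 hx₁)
  ext y
  constructor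
  · rintro ⟨hxy, hy | hy⟩
    · exact hy
    · have hy' := mem_pointsDiff.1 hy
      refine absurd ?_ hy'.2
      rw [e]
      exact ⟨h₂.1 hy'.1, (collinearityGraph_adj.1 hxy).2⟩
  · intro hy
    refine ⟨collinearityGraph_adj.2 ⟨?_, hx₁ (mem_pointsDiff.1 hy).1⟩, Or.inl hy⟩
    rintro rfl
    exact hx (Or.inl hy)

theorem le_ker_of_neighborSet_inter_eq (h₁ : L₁ ≤ P) (hP : pol.IsIsotropic P) (h : ¬ L₁ ≤ L₂)
    {x : pol.Point}
    (hN : pol.collinearityGraph.neighborSet x ∩ (pol.pointsDiff L₁ L₂ ∪ pol.pointsDiff L₂ L₁) =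
      pol.pointsDiff L₁ L₂) : L₁ ≤ LinearMap.ker (pol.form x.rep) := by
  refine le_ker_of_pointsDiff h₁ hP h fun y hy => ?_
  rw [← hN] at hy
  exact (collinearityGraph_adj.1 hy.1).2

/-- The numbers of neighbours of `x` in the two parts are numbers of points of subspaces
`L₁ ⊓ x⊥`, `L₂ ⊓ x⊥` outside `L₁ ⊓ L₂ ⊓ x⊥`. They agree unless exactly one of `L₁`, `L₂` lies
in `x⊥`. -/
theorem ncard_neighborSet_inter_eq [Finite K] [FiniteDimensional K V] (hP : pol.IsIsotropic P)
    (h₁ : IsHyperplaneOf L₁ P) (h₂ : IsHyperplaneOf L₂ P) {x : pol.Point}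
    (hx : x ∉ pol.pointsDiff L₁ L₂ ∪ pol.pointsDiff L₂ L₁)
    (hiff : L₁ ≤ LinearMap.ker (pol.form x.rep) ↔ L₂ ≤ LinearMap.ker (pol.form x.rep)) :
    (pol.collinearityGraph.neighborSet x ∩ pol.pointsDiff L₁ L₂).ncard =
      (pol.collinearityGraph.neighborSet x ∩ pol.pointsDiff L₂ L₁).ncard := by
  set H := LinearMap.ker (pol.form x.rep) with hH
  have e : ∀ L M : Submodule K V, x ∉ pol.pointsDiff L M →
      pol.collinearityGraph.neighborSet x ∩ pol.pointsDiff L M = pol.pointsDiff (L ⊓ H) M := by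
    intro L M hxL
    ext y
    rw [Set.mem_inter_iff, mem_pointsDiff, mem_pointsDiff, SimpleGraph.mem_neighborSet,
      collinearityGraph_adj, Submodule.mem_inf, hH, LinearMap.mem_ker]
    constructor
    · rintro ⟨⟨-, h3⟩, h4, h5⟩
      exact ⟨⟨h4, h3⟩, h5⟩
    · rintro ⟨⟨h4, h3⟩, h5⟩
      refine ⟨⟨?_, h3⟩, h4, h5⟩
      rintro rfl
      exact hxL (mem_pointsDiff.2 ⟨h4, h5⟩)
  rw [e _ _ fun h => hx (Or.inl h), e _ _ fun h => hx (Or.inr h)]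
  refine ncard_pointsDiff_eq (hP.mono (inf_le_left.trans h₁.1)) (hP.mono (inf_le_left.trans h₂.1))
    ?_ (by rw [inf_right_comm, inf_comm L₁ L₂, inf_right_comm])
  have := h₁.2
  have := h₂.2
  by_cases h : L₁ ≤ H
  · rw [inf_eq_left.2 h, inf_eq_left.2 (hiff.1 h)]
    omega
  · have := Submodule.finrank_inf_ker_add_one h
    have := Submodule.finrank_inf_ker_add_one fun h' => h (hiff.2 h')
    rw [← hH] at *
    omega

theorem isSwitchingSet [Finite K] [FiniteDimensional K V] (hP : pol.IsIsotropic P)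
    (h₁ : IsHyperplaneOf L₁ P) (h₂ : IsHyperplaneOf L₂ P) :
    IsSwitchingSet pol.collinearityGraph (pol.pointsDiff L₁ L₂) (pol.pointsDiff L₂ L₁) := by
  have hcard : (pol.pointsDiff L₁ L₂).ncard = (pol.pointsDiff L₂ L₁).ncard :=
    ncard_pointsDiff_eq (hP.mono h₁.1) (hP.mono h₂.1) (by have := h₁.2; have := h₂.2; omega)
      (inf_comm _ _)
  have hcl : ∀ x ∈ pol.pointsDiff L₁ L₂ ∪ pol.pointsDiff L₂ L₁,
      ∀ y ∈ pol.pointsDiff L₁ L₂ ∪ pol.pointsDiff L₂ L₁, x ≠ y →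
        pol.collinearityGraph.Adj x y := fun x hx y hy hxy =>
    collinearityGraph_adj.2 ⟨hxy, hP.form_eq_zero (rep_mem_of_mem_union h₁.1 h₂.1 hx)
      (rep_mem_of_mem_union h₁.1 h₂.1 hy)⟩
  refine ⟨disjoint_pointsDiff _ _, hcard, ⟨(pol.pointsDiff L₁ L₂).ncard - 1, ?_, ?_⟩,
    ⟨_, inducesRegular_of_pairwise_adj hcl⟩, fun x hx => ?_⟩
  · exact inducesRegular_of_pairwise_adj fun x hx y hy => hcl x (Or.inl hx) y (Or.inl hy)
  · rw [hcard]
    exact inducesRegular_of_pairwise_adj fun x hx y hy => hcl x (Or.inr hx) y (Or.inr hy)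
  · by_cases hx₁ : L₁ ≤ LinearMap.ker (pol.form x.rep) <;>
      by_cases hx₂ : L₂ ≤ LinearMap.ker (pol.form x.rep)
    · exact Or.inl (ncard_neighborSet_inter_eq hP h₁ h₂ hx (iff_of_true hx₁ hx₂))
    · exact Or.inr (Or.inl (neighborSet_inter_eq h₁ h₂ hx hx₁ hx₂))
    · rw [Set.union_comm] at hx ⊢
      exact Or.inr (Or.inr (neighborSet_inter_eq h₂ h₁ hx hx₂ hx₁))
    · exact Or.inl (ncard_neighborSet_inter_eq hP h₁ h₂ hx (iff_of_false hx₁ hx₂))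

section Switched

variable [FiniteDimensional K V]

theorem switchedGraph_adj_of_le_left (hP : pol.IsIsotropic P) (h₁ : IsHyperplaneOf L₁ P)
    (h₂ : IsHyperplaneOf L₂ P) (h : L₁ ≠ L₂) {x y : pol.Point}
    (hx : x ∉ pol.pointsDiff L₁ L₂ ∪ pol.pointsDiff L₂ L₁)
    (hy : y ∈ pol.pointsDiff L₁ L₂ ∪ pol.pointsDiff L₂ L₁)
    (hx₁ : L₁ ≤ LinearMap.ker (pol.form x.rep)) (hx₂ : ¬ L₂ ≤ LinearMap.ker (pol.form x.rep)) :
    (switchedGraph pol.collinearityGraph (pol.pointsDiff L₁ L₂) (pol.pointsDiff L₂ L₁)).Adj x y ↔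
      y ∈ pol.pointsDiff L₂ L₁ := by
  rw [switchedGraph_adj_of_notMem _ hx hy, switchedNeighbors, if_neg,
    if_pos (neighborSet_inter_eq h₁ h₂ hx hx₁ hx₂)]
  intro hN
  rw [Set.union_comm] at hN
  exact hx₂ (le_ker_of_neighborSet_inter_eq h₂.1 hP (fun h' => h (h₂.eq_of_le h₁ h').symm) hN)

theorem switchedGraph_adj_of_le_right (h₁ : IsHyperplaneOf L₁ P)
    (h₂ : IsHyperplaneOf L₂ P) {x y : pol.Point}
    (hx : x ∉ pol.pointsDiff L₁ L₂ ∪ pol.pointsDiff L₂ L₁)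
    (hy : y ∈ pol.pointsDiff L₁ L₂ ∪ pol.pointsDiff L₂ L₁)
    (hx₁ : ¬ L₁ ≤ LinearMap.ker (pol.form x.rep)) (hx₂ : L₂ ≤ LinearMap.ker (pol.form x.rep)) :
    (switchedGraph pol.collinearityGraph (pol.pointsDiff L₁ L₂) (pol.pointsDiff L₂ L₁)).Adj x y ↔
      y ∈ pol.pointsDiff L₁ L₂ := by
  rw [switchedGraph_adj_of_notMem _ hx hy, switchedNeighbors, if_pos]
  rw [Set.union_comm] at hx ⊢
  exact neighborSet_inter_eq h₂ h₁ hx hx₂ hx₁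

theorem switchedGraph_adj_of_not_le (hP : pol.IsIsotropic P) (h₁ : IsHyperplaneOf L₁ P)
    (h₂ : IsHyperplaneOf L₂ P) (h : L₁ ≠ L₂) {x y : pol.Point}
    (hx : x ∉ pol.pointsDiff L₁ L₂ ∪ pol.pointsDiff L₂ L₁)
    (hy : y ∈ pol.pointsDiff L₁ L₂ ∪ pol.pointsDiff L₂ L₁)
    (hx₁ : ¬ L₁ ≤ LinearMap.ker (pol.form x.rep)) (hx₂ : ¬ L₂ ≤ LinearMap.ker (pol.form x.rep)) :
    (switchedGraph pol.collinearityGraph (pol.pointsDiff L₁ L₂) (pol.pointsDiff L₂ L₁)).Adj x y ↔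
      pol.form x.rep y.rep = 0 := by
  rw [switchedGraph_adj_of_notMem _ hx hy, switchedNeighbors, if_neg, if_neg]
  · rw [Set.mem_inter_iff, SimpleGraph.mem_neighborSet, collinearityGraph_adj]
    refine ⟨fun h' => h'.1.2, fun h' => ⟨⟨?_, h'⟩, hy⟩⟩
    rintro rfl
    exact hx hy
  · exact fun hN => hx₁ (le_ker_of_neighborSet_inter_eq h₁.1 hP
      (fun h' => h (h₁.eq_of_le h₂ h')) hN)
  · intro hN
    rw [Set.union_comm] at hN
    exact hx₂ (le_ker_of_neighborSet_inter_eq h₂.1 hP (fun h' => h (h₂.eq_of_le h₁ h').symm) hN)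

end Switched

end ClassicalPolarity

/-! ### Prescribing orthogonality relations -/

/-- A functional that vanishes on `S` but at neither of two vectors outside `S`. -/
theorem Submodule.exists_le_ker_of_notMem_of_notMem {K V : Type*} [Field K] [AddCommGroup V]
    [Module K V] {S : Submodule K V} {u v : V} (hu : u ∉ S) (hv : v ∉ S) :
    ∃ f : V →ₗ[K] K, S ≤ LinearMap.ker f ∧ f u ≠ 0 ∧ f v ≠ 0 := by
  obtain ⟨f, hfu, hf⟩ := Submodule.exists_le_ker_of_notMem hu
  obtain ⟨g, hgv, hg⟩ := Submodule.exists_le_ker_of_notMem hv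
  by_cases h1 : f v = 0
  · by_cases h2 : g u = 0
    · refine ⟨f + g, fun s hs => ?_, by simpa [h2] using hfu, by simpa [h1] using hgv⟩
      have e1 : f s = 0 := hf hs
      have e2 : g s = 0 := hg hs
      simp [e1, e2]
    · exact ⟨g, hg, h2, hgv⟩
  · exact ⟨f, hf, hfu, h1⟩

namespace ClassicalPolarity

variable {K V : Type*} [Field K] [AddCommGroup V] [Module K V] [FiniteDimensional K V]
  {pol : ClassicalPolarity K V} {P L₁ L₂ : Submodule K V}

/-- An isotropic subspace whose dimension is the rank is a maximal isotropic subspace. -/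
theorem HasRank.rep_mem_of_le_ker {d : ℕ} (hd : pol.HasRank d) (hP : pol.IsIsotropic P)
    (hPd : Module.finrank K P = d) {z : pol.Point} (hz : P ≤ LinearMap.ker (pol.form z.rep)) :
    z.rep ∈ P := by
  have hiso : pol.IsIsotropic ((K ∙ z.rep) ⊔ P) := by
    refine pol.isIsotropic_sup (pol.isIsotropic_span_singleton z.form_rep_self) hP ?_
    intro u hu v hv
    obtain ⟨a, rfl⟩ := Submodule.mem_span_singleton.1 hu
    have h : pol.form z.rep v = 0 := hz hv
    simp [h]
  have hle := hd.2 ⟨_, hiso, rfl⟩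
  have e : P = (K ∙ z.rep) ⊔ P :=
    Submodule.eq_of_le_of_finrank_le le_sup_right (by omega)
  rw [e]
  exact Submodule.mem_sup_left (Submodule.mem_span_singleton_self _)

variable [Finite K]

/-- Every hyperplane of an isotropic subspace `P` is the intersection of `P` with `x⊥` for some
point `x`. -/
theorem exists_point_le_ker (hP : pol.IsIsotropic P) (h₁ : IsHyperplaneOf L₁ P) :
    ∃ x : pol.Point, L₁ ≤ LinearMap.ker (pol.form x.rep) ∧
      ¬ P ≤ LinearMap.ker (pol.form x.rep) := by
  obtain ⟨t, htP, ht⟩ : ∃ t ∈ P, t ∉ L₁ := by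
    refine SetLike.not_le_iff_exists.1 fun h => ?_
    have := Submodule.finrank_mono h
    have := h₁.2
    omega
  obtain ⟨f, hft, hf⟩ := Submodule.exists_le_ker_of_notMem ht
  obtain ⟨v, rfl⟩ := pol.exists_form_eq f
  have htt := hP.form_eq_zero htP htP
  obtain ⟨a, ha⟩ := pol.exists_isotropic_add_smul htt hft
  have hw : ∀ y ∈ P, pol.form (v + a • t) y = pol.form v y := fun y hy => by
    simp [hP.form_eq_zero htP hy]
  have hw0 : v + a • t ≠ 0 := by
    intro h0
    apply hft
    rw [← hw t htP, h0, map_zero, LinearMap.zero_apply]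
  refine ⟨Point.mk pol _ hw0 ha, fun y hy => ?_, fun h => hft ?_⟩
  · rw [LinearMap.mem_ker, Point.form_rep_mk_left, hw y (h₁.1 hy)]
    exact hf hy
  · rw [← hw t htP, ← Point.form_rep_mk_left hw0 ha]
    exact h htP

/-- A point orthogonal to `x` and `p` but not to `l` and `e`. The form represents a functional that
vanishes at `x` and `p` but not at `l` and `e`. Adding multiples of `l` to the representing vector
changes none of these values, since `l` is orthogonal to all four vectors, and one of these
modifications is isotropic. -/
theorem exists_point_orthogonal (hP : pol.IsIsotropic P) {x : V} (hx : x ∉ P) {p l e : V}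
    (hp : p ∈ P) (hl : l ∈ P) (he : e ∈ P) (hlp : l ∉ K ∙ p) (hep : e ∉ K ∙ p)
    (hlx : pol.form l x = 0) :
    ∃ w : pol.Point, pol.form w.rep x = 0 ∧ pol.form w.rep p = 0 ∧ pol.form w.rep l ≠ 0 ∧
      pol.form w.rep e ≠ 0 := by
  have key : ∀ u ∈ P, u ∉ K ∙ p → u ∉ (K ∙ x) ⊔ (K ∙ p) := by
    intro u hu hup h
    obtain ⟨y, hy, z, hz, rfl⟩ := Submodule.mem_sup.1 h
    obtain ⟨a, rfl⟩ := Submodule.mem_span_singleton.1 hy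
    have hzP : z ∈ P := (Submodule.span_singleton_le_iff_mem p P).2 hp hz
    have hax : a • x ∈ P := by simpa using sub_mem hu hzP
    have ha : a = 0 := by
      by_contra ha
      exact hx ((Submodule.smul_mem_iff P ha).1 hax)
    rw [ha, zero_smul, zero_add] at hup
    exact hup hz
  obtain ⟨f, hf, hfl, hfe⟩ :=
    Submodule.exists_le_ker_of_notMem_of_notMem (key l hl hlp) (key e he hep)
  obtain ⟨v, rfl⟩ := pol.exists_form_eq f
  obtain ⟨a, ha⟩ := pol.exists_isotropic_add_smul (hP.form_eq_zero hl hl) hfl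
  have hw : ∀ y, pol.form l y = 0 → pol.form (v + a • l) y = pol.form v y := fun y hy => by
    simp [hy]
  have hll := hw l (hP.form_eq_zero hl hl)
  have hw0 : v + a • l ≠ 0 := by
    intro h0
    apply hfl
    rw [← hll, h0, map_zero, LinearMap.zero_apply]
  refine ⟨Point.mk pol _ hw0 ha, ?_, ?_, ?_, ?_⟩
  · rw [Point.form_rep_mk_left, hw x hlx]
    exact hf (Submodule.mem_sup_left (Submodule.mem_span_singleton_self x))
  · rw [Point.form_rep_mk_left, hw p (hP.form_eq_zero hl hp)]
    exact hf (Submodule.mem_sup_right (Submodule.mem_span_singleton_self p))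
  · rwa [ne_eq, Point.form_rep_mk_left, hll]
  · rwa [ne_eq, Point.form_rep_mk_left, hw e (hP.form_eq_zero hl he)]

/-! ### The switched graph is not isomorphic to the collinearity graph -/

end ClassicalPolarity

/-- In the graph `G`, some vertex `z` other than `x` and `y` is equal or adjacent to every vertex
that is equal or adjacent to `x` and equal or adjacent to `y`. For adjacent points `x`, `y` of a
polar space this holds for every further point `z` of the line `xy`. -/
def HasThirdVertex {α : Type*} (G : SimpleGraph α) (x y : α) : Prop :=
  ∃ z, z ≠ x ∧ z ≠ y ∧ ∀ w, (w = x ∨ G.Adj w x) → (w = y ∨ G.Adj w y) → (w = z ∨ G.Adj w z)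

theorem HasThirdVertex.map {α β : Type*} {G : SimpleGraph α} {H : SimpleGraph β} (e : G ≃g H)
    {x y : α} (h : HasThirdVertex G x y) : HasThirdVertex H (e x) (e y) := by
  obtain ⟨z, hzx, hzy, hz⟩ := h
  refine ⟨e z, e.injective.ne hzx, e.injective.ne hzy, fun w h1 h2 => ?_⟩
  obtain ⟨w, rfl⟩ := e.surjective w
  rw [e.injective.eq_iff, e.map_adj_iff] at *
  exact hz w h1 h2

namespace ClassicalPolarity

variable {K V : Type*} [Field K] [AddCommGroup V] [Module K V]
  {pol : ClassicalPolarity K V} {P L₁ L₂ : Submodule K V}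

theorem hasThirdVertex_of_adj {x y : pol.Point} (h : pol.collinearityGraph.Adj x y) :
    HasThirdVertex pol.collinearityGraph x y := by
  obtain ⟨hxy, h⟩ := collinearityGraph_adj.1 h
  have h' := pol.form_eq_zero_comm h
  have hz : pol.form (x.rep + y.rep) (x.rep + y.rep) = 0 := by
    simp [h, h', x.form_rep_self, y.form_rep_self]
  have hz0 : x.rep + y.rep ≠ 0 := fun h0 =>
    hxy (Point.eq_of_rep_eq_smul (a := -1) (by
      rw [neg_one_smul]
      exact eq_neg_of_add_eq_zero_left h0))
  obtain ⟨a, ha, e⟩ := Point.exists_rep_mk hz0 hz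
  set z := Point.mk pol _ hz0 hz
  refine ⟨z, fun hzx => hxy.symm ?_, fun hzy => hxy ?_, fun w hwx hwy => ?_⟩
  · refine Point.eq_of_rep_eq_smul (a := a⁻¹ - 1) ?_
    rw [hzx] at e
    rw [sub_smul, one_smul, (inv_smul_eq_iff₀ ha).2 e]
    abel
  · refine Point.eq_of_rep_eq_smul (a := a⁻¹ - 1) ?_
    rw [hzy] at e
    rw [sub_smul, one_smul, (inv_smul_eq_iff₀ ha).2 e]
    abel
  · have hx : pol.form w.rep x.rep = 0 := by
      rcases hwx with rfl | hwx
      · exact w.form_rep_self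
      · exact (collinearityGraph_adj.1 hwx).2
    have hy : pol.form w.rep y.rep = 0 := by
      rcases hwy with rfl | hwy
      · exact w.form_rep_self
      · exact (collinearityGraph_adj.1 hwy).2
    by_cases hwz : w = z
    · exact Or.inl hwz
    · exact Or.inr (collinearityGraph_adj.2 ⟨hwz, by rw [e]; simp [hx, hy]⟩)

variable [Finite K] [FiniteDimensional K V]

/-- Let `P` be a maximal isotropic subspace of dimension at least three, let `x` be a point with
`P ∩ x⊥ = L₁`, and let `p` be a point in `L₂` but not in `L₁`. After switching, `x` and `p` are
adjacent but there is no third vertex for them. -/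
theorem not_hasThirdVertex_switchedGraph {d : ℕ} (hd : pol.HasRank d) (hP : pol.IsIsotropic P)
    (hPd : Module.finrank K P = d) (h3 : 3 ≤ d) (h₁ : IsHyperplaneOf L₁ P)
    (h₂ : IsHyperplaneOf L₂ P) (h : L₁ ≠ L₂) {x p : pol.Point}
    (hx₁ : L₁ ≤ LinearMap.ker (pol.form x.rep)) (hxP : ¬ P ≤ LinearMap.ker (pol.form x.rep))
    (hp : p ∈ pol.pointsDiff L₂ L₁) :
    (switchedGraph pol.collinearityGraph
        (pol.pointsDiff L₁ L₂) (pol.pointsDiff L₂ L₁)).Adj x p ∧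
      ¬ HasThirdVertex (switchedGraph pol.collinearityGraph
        (pol.pointsDiff L₁ L₂) (pol.pointsDiff L₂ L₁)) x p := by
  set C₁ := pol.pointsDiff L₁ L₂ with hC₁
  set C₂ := pol.pointsDiff L₂ L₁ with hC₂
  set G := switchedGraph pol.collinearityGraph C₁ C₂ with hG
  have hpm := mem_pointsDiff.1 hp
  have hpP : p.rep ∈ P := h₂.1 hpm.1
  have hpC : p ∈ C₁ ∪ C₂ := Or.inr hp
  have hxP' : x.rep ∉ P := fun hx => hxP fun y hy => hP.form_eq_zero hx hy
  have hC : ∀ z : pol.Point, z.rep ∉ P → z ∉ C₁ ∪ C₂ := fun z hz hz' =>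
    hz (rep_mem_of_mem_union h₁.1 h₂.1 hz')
  have hxC := hC x hxP'
  have hsup := h₁.sup_eq h₂ h
  have hx₂ : ¬ L₂ ≤ LinearMap.ker (pol.form x.rep) := fun hx₂ =>
    hxP (hsup ▸ sup_le hx₁ hx₂)
  have hxadj : ∀ y ∈ C₁ ∪ C₂, (G.Adj x y ↔ y ∈ C₂) := fun y hy =>
    switchedGraph_adj_of_le_left hP h₁ h₂ h hxC hy hx₁ hx₂
  have hout : ∀ y z, y ∉ C₁ ∪ C₂ → z ∉ C₁ ∪ C₂ →
      (G.Adj y z ↔ y ≠ z ∧ pol.form y.rep z.rep = 0) := fun y z hy hz =>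
    (switchedGraph_adj_of_iff _ (iff_of_false hy hz)).trans collinearityGraph_adj
  refine ⟨(hxadj p hpC).2 hp, ?_⟩
  rintro ⟨z, hzx, hzp, hz⟩
  have hspan : ∀ u ∈ L₁, u ≠ 0 → u ∉ K ∙ p.rep := by
    intro u hu hu0 hup
    obtain ⟨a, rfl⟩ := Submodule.mem_span_singleton.1 hup
    have ha : a ≠ 0 := by
      rintro rfl
      exact hu0 (zero_smul _ _)
    exact hpm.2 ((Submodule.smul_mem_iff L₁ ha).1 hu)
  -- a point `w` as in `exists_point_orthogonal` is not affected by switching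
  have hw : ∀ l ∈ L₁, l ≠ 0 → ∀ e ∈ L₂, e ∉ K ∙ p.rep → ∃ w : pol.Point, w ∉ C₁ ∪ C₂ ∧
      pol.form w.rep x.rep = 0 ∧ pol.form w.rep l ≠ 0 ∧ pol.form w.rep e ≠ 0 ∧
      (w = z ∨ G.Adj w z) ∧ (∀ y ∈ C₁ ∪ C₂, G.Adj w y → pol.form w.rep y.rep = 0) := by
    intro l hl hl0 e he hep
    obtain ⟨w, hwx, hwp, hwl, hwe⟩ := exists_point_orthogonal hP hxP' hpP (h₁.1 hl) (h₂.1 he)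
      (hspan l hl hl0) hep (pol.form_eq_zero_comm (hx₁ hl))
    have hwC : w ∉ C₁ ∪ C₂ := hC w fun hw => hwl (hP.form_eq_zero hw (h₁.1 hl))
    have hadj : ∀ y ∈ C₁ ∪ C₂, (G.Adj w y ↔ pol.form w.rep y.rep = 0) := fun y hy =>
      switchedGraph_adj_of_not_le hP h₁ h₂ h hwC hy (fun h' => hwl (h' hl)) fun h' => hwe (h' he)
    refine ⟨w, hwC, hwx, hwl, hwe, hz w ?_ (Or.inr ((hadj p hpC).2 hwp)), fun y hy =>
      (hadj y hy).1⟩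
    by_cases hwx' : w = x
    · exact Or.inl hwx'
    · exact Or.inr ((hout w x hwC hxC).2 ⟨hwx', hwx⟩)
  have hxz := hz x (Or.inl rfl) (Or.inr ((hxadj p hpC).2 hp))
  replace hxz : G.Adj x z := hxz.resolve_left fun h' => hzx h'.symm
  by_cases hzP : z.rep ∈ P
  · by_cases hz₂ : z.rep ∈ L₂
    · -- `z` lies in `L₂`
      have hL₁ : L₁ ≠ ⊥ := by
        intro h0
        have := h₁.2
        rw [h0, finrank_bot] at this
        omega
      obtain ⟨l, hl, hl0⟩ := Submodule.exists_mem_ne_zero_of_ne_bot hL₁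
      obtain ⟨w, hwC, -, -, hwz, hadj, hwadj⟩ := hw l hl hl0 z.rep hz₂ fun hzp' => by
        obtain ⟨a, ha⟩ := Submodule.mem_span_singleton.1 hzp'
        exact hzp (Point.eq_of_rep_eq_smul ha.symm)
      rcases hadj with rfl | hadj
      · exact hwz w.form_rep_self
      · by_cases hzC : z ∈ C₁ ∪ C₂
        · exact hwz (hwadj z hzC hadj)
        · exact hwz ((hout w z hwC hzC).1 hadj).2
    · -- `z` lies in `P` but not in `L₂`, and hence is not adjacent to `x`
      by_cases hzC : z ∈ C₁ ∪ C₂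
      · exact hz₂ (mem_pointsDiff.1 ((hxadj z hzC).1 hxz)).1
      · have hxz' := ((hout x z hxC hzC).1 hxz).2
        have hH : IsHyperplaneOf (P ⊓ LinearMap.ker (pol.form x.rep)) P :=
          ⟨inf_le_left, Submodule.finrank_inf_ker_add_one hxP⟩
        have hz₁ : z.rep ∈ L₁ := by
          rw [h₁.eq_of_le hH (le_inf h₁.1 hx₁)]
          exact ⟨hzP, hxz'⟩
        exact hzC (Or.inl (mem_pointsDiff.2 ⟨hz₁, hz₂⟩))
  have hzC := hC z hzP
  by_cases hz₁ : L₁ ≤ LinearMap.ker (pol.form z.rep)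
  · -- maximality of `⟨x, L₁⟩` yields `z ∈ ⟨x, L₁⟩`
    have hzx' := ((hout x z hxC hzC).1 hxz).2
    have hM : pol.IsIsotropic ((K ∙ x.rep) ⊔ L₁) := by
      refine pol.isIsotropic_sup (pol.isIsotropic_span_singleton x.form_rep_self)
        (hP.mono h₁.1) fun u hu v hv => ?_
      obtain ⟨a, rfl⟩ := Submodule.mem_span_singleton.1 hu
      have : pol.form x.rep v = 0 := hx₁ hv
      simp [this]
    have hMd : Module.finrank K ↥((K ∙ x.rep) ⊔ L₁) = d := by
      refine le_antisymm (hd.2 ⟨_, hM, rfl⟩) ?_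
      have hlt : L₁ < (K ∙ x.rep) ⊔ L₁ := by
        refine lt_of_le_of_ne le_sup_right fun e => hxP' (h₁.1 ?_)
        rw [e]
        exact Submodule.mem_sup_left (Submodule.mem_span_singleton_self _)
      have := Submodule.finrank_lt_finrank_of_lt hlt
      have := h₁.2
      omega
    have hzM : z.rep ∈ (K ∙ x.rep) ⊔ L₁ := by
      refine hd.rep_mem_of_le_ker hM hMd (sup_le ?_ hz₁)
      rw [Submodule.span_singleton_le_iff_mem]
      exact pol.form_eq_zero_comm hzx'
    obtain ⟨y, hy, l, hl, hyl⟩ := Submodule.mem_sup.1 hzM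
    obtain ⟨a, rfl⟩ := Submodule.mem_span_singleton.1 hy
    have hl0 : l ≠ 0 := by
      rintro rfl
      rw [add_zero] at hyl
      exact hzx (Point.eq_of_rep_eq_smul hyl.symm)
    obtain ⟨e, he, hep⟩ : ∃ e ∈ L₂, e ∉ K ∙ p.rep := by
      refine SetLike.not_le_iff_exists.1 fun hle => ?_
      have := Submodule.finrank_mono hle
      rw [finrank_span_singleton p.rep_ne_zero] at this
      have := h₂.2
      omega
    obtain ⟨w, hwC, hwx, hwl, -, hadj, -⟩ := hw l hl hl0 e he hep
    have hwz : pol.form w.rep z.rep = 0 := by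
      rcases hadj with rfl | hadj
      · exact w.form_rep_self
      · exact ((hout w z hwC hzC).1 hadj).2
    rw [← hyl] at hwz
    exact hwl (by simpa [hwx] using hwz)
  -- the hyperplane of `P` joined to `z` after switching differs from `L₂`
  have hnadj : ∃ y ∈ C₂, ¬ G.Adj z y := by
    by_cases hz₂ : L₂ ≤ LinearMap.ker (pol.form z.rep)
    · refine ⟨p, hp, fun hadj => ?_⟩
      exact hpm.2 (mem_pointsDiff.1
        ((switchedGraph_adj_of_le_right h₁ h₂ hzC hpC hz₁ hz₂).1 hadj)).1
    · by_contra! hall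
      refine hz₂ (le_ker_of_pointsDiff h₂.1 hP (fun h' => h (h₂.eq_of_le h₁ h').symm)
        fun y hy => ?_)
      exact (switchedGraph_adj_of_not_le hP h₁ h₂ h hzC (Or.inr hy) hz₁ hz₂).1 (hall y hy)
  obtain ⟨y, hy, hzy⟩ := hnadj
  have hyp : y = p ∨ G.Adj y p := by
    by_cases hyp : y = p
    · exact Or.inl hyp
    · refine Or.inr ((switchedGraph_adj_of_iff _ (iff_of_true (Or.inr hy) hpC)).2 ?_)
      exact collinearityGraph_adj.2
        ⟨hyp, hP.form_eq_zero (h₂.1 (mem_pointsDiff.1 hy).1) hpP⟩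
  rcases hz y (Or.inr ((hxadj y (Or.inr hy)).2 hy).symm) hyp with rfl | hadj
  · exact hzC (Or.inr hy)
  · exact hzy hadj.symm

theorem isEmpty_iso_switchedGraph {d : ℕ} (hd : pol.HasRank d) (hP : pol.IsIsotropic P)
    (hPd : Module.finrank K P = d) (h3 : 3 ≤ d) (h₁ : IsHyperplaneOf L₁ P)
    (h₂ : IsHyperplaneOf L₂ P) (h : L₁ ≠ L₂) :
    IsEmpty (pol.collinearityGraph ≃g
      switchedGraph pol.collinearityGraph (pol.pointsDiff L₁ L₂) (pol.pointsDiff L₂ L₁)) := by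
  refine ⟨fun e => ?_⟩
  obtain ⟨x, hx₁, hxP⟩ := exists_point_le_ker hP h₁
  obtain ⟨p, hp⟩ := pointsDiff_nonempty h₂.1 hP fun h' => h (h₂.eq_of_le h₁ h').symm
  obtain ⟨hadj, hnot⟩ := not_hasThirdVertex_switchedGraph hd hP hPd h3 h₁ h₂ h hx₁ hxP hp
  apply hnot
  have hadj' : pol.collinearityGraph.Adj (e.symm x) (e.symm p) := e.symm.map_adj_iff.2 hadj
  simpa using (hasThirdVertex_of_adj hadj').map e

end ClassicalPolarity

theorem theorem6 {K V : Type*} [Field K] [Finite K] [AddCommGroup V] [Module K V]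
    [FiniteDimensional K V] (pol : ClassicalPolarity K V) (d : ℕ) (hd : pol.HasRank d) :
    (∀ (m : ℕ) (P L₁ L₂ : Submodule K V), pol.IsIsotropic P → Module.finrank K P = m →
      IsHyperplaneOf L₁ P → IsHyperplaneOf L₂ P → L₁ ≠ L₂ →
        IsSwitchingSet pol.collinearityGraph (pol.pointsDiff L₁ L₂) (pol.pointsDiff L₂ L₁) ∧
        Cospectral pol.collinearityGraph
          (switchedGraph pol.collinearityGraph (pol.pointsDiff L₁ L₂) (pol.pointsDiff L₂ L₁)) ∧
        (d = m → 3 ≤ m → IsEmpty (pol.collinearityGraph ≃g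
          switchedGraph pol.collinearityGraph (pol.pointsDiff L₁ L₂) (pol.pointsDiff L₂ L₁)))) ∧
    (3 ≤ d → ¬ DeterminedBySpectrum pol.collinearityGraph) := by
  refine ⟨?_, fun h3 hDS => ?_⟩
  · rintro m P L₁ L₂ hP rfl h₁ h₂ h
    have hs := ClassicalPolarity.isSwitchingSet hP h₁ h₂
    exact ⟨hs, hs.cospectral, fun hdm h3 =>
      ClassicalPolarity.isEmpty_iso_switchedGraph hd hP hdm.symm (hdm ▸ h3) h₁ h₂ h⟩
  · obtain ⟨P, hP, hPd⟩ := hd.1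
    obtain ⟨L₁, L₂, h₁, h₂, h⟩ := IsHyperplaneOf.exists_ne P (by omega)
    obtain ⟨e⟩ := hDS _ (ClassicalPolarity.isSwitchingSet hP h₁ h₂).cospectral
    exact (ClassicalPolarity.isEmpty_iso_switchedGraph hd hP hPd h3 h₁ h₂ h).false e
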